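/- Let $n\ge 1$ and let $S_n$ be the symmetric group on $\{1,\dots,n\}$, viewed as a Coxeter group with generators the simple transpositions $s_i=(i\;\,i+1)$, $1\le i\le n-1$, length function $\ell$, identity $e$ and Bruhat order $\le$ (products are compositions of maps, right to left). Every $w\in S_n$ factorizes uniquely as $w=w^{(1)}w^{(2)}\cdots w^{(n-1)}$ where, for each $i$, $w^{(i)}$ lies in the subgroup generated by $s_1,\dots,s_i$ and $\ell(s_jw^{(i)})>\ell(w^{(i)})$ for all $j<i$. Put $$L_n(w):=\bigl(0,\ell(w^{(1)}),\dots,\ell(w^{(n-1)})\bigr)\in\{0,\dots,n-1\}^n .$$ Call $w\in S_n$ \emph{$L_n$-principal} if $$\{z\in S_n: L_n(e)\le L_n(z)\le L_n(w)\text{ componentwise}\}=\{z\in S_n: e\le z\le w\}.$$ For an $L_n$-principal $w$ let $O_w$ be the set of all vectors $L_n(v)$, with $v$ an $L_n$-principal element of $S_n$, that are rearrangements of the entries of $L_n(w)$; call $w$ \emph{$L_n$-unimodal} if it is $L_n$-principal and $L_n(w)$ is the lexicographic minimum of $O_w$. A word $x\in\{0,\dots,n-1\}^n$ is a \emph{Fubini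 word} if $\{x_1,\dots,x_n\}=\{0,1,\dots,\max_i x_i\}$. A permutation $w\in S_n$ is \emph{unimodal} if there is $i\in\{0,\dots,n\}$ such that $w(j)<w(j+1)$ for all $1\le j<i$ with $j<n$, and $w(j)>w(j+1)$ for all $i<j<n$. Then for every $u\in S_n$ the following are equivalent: 1. $u$ is $L_n$-unimodal; 2. $L_n(u)$ is a weakly increasing Fubini word; 3. $u$ is a unimodal permutation. -/

import Mathlib

namespace Lehmer

section Coxeter

/-! Notions for a group `W` with linearly ordered generators `s 0, …, s (r - 1)`. -/

variable {W : Type*} [Group W] {r : ℕ}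

/-- The product in `W` of a word in the generators. -/
def wordProd (s : Fin r → W) (l : List (Fin r)) : W := (l.map s).prod

/-- The Coxeter length: the least length of a word in the generators representing `w`. -/
noncomputable def len (s : Fin r → W) (w : W) : ℕ :=
  sInf {k | ∃ l : List (Fin r), wordProd s l = w ∧ l.length = k}

/-- A word is reduced if no shorter word represents the same element. -/
def IsReduced (s : Fin r → W) (l : List (Fin r)) : Prop := l.length = len s (wordProd s l)

/-- The Bruhat order, through the subword property: some reduced word of `v` has a subword which
is a reduced word of `u`. -/
def BruhatLE (s : Fin r → W) (u v : W) : Prop :=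
  ∃ l : List (Fin r), IsReduced s l ∧ wordProd s l = v ∧
    ∃ l' : List (Fin r), l'.Sublist l ∧ IsReduced s l' ∧ wordProd s l' = u

/-- The parabolic subgroup `W_J`. -/
def parabolic (s : Fin r → W) (J : Set (Fin r)) : Subgroup W := Subgroup.closure (s '' J)

/-- The quotient `^I W_J`: the `w ∈ W_J` with `ℓ(s w) > ℓ(w)` for all `s ∈ I`. -/
def leftQuotient (s : Fin r → W) (I J : Set (Fin r)) : Set W :=
  {w | w ∈ parabolic s J ∧ ∀ i ∈ I, len s w < len s (s i * w)}

/-- `f` is the factorization `w = w⁽¹⁾ w⁽²⁾ ⋯ w⁽ʳ⁾` in which `w⁽ⁱ⁾` lies in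
`^{s₁, …, sᵢ₋₁} W_{s₁, …, sᵢ}`. In a Coxeter system it exists and is unique. -/
def IsParabolicFactorization (s : Fin r → W) (w : W) (f : Fin r → W) : Prop :=
  (∀ i, f i ∈ leftQuotient s (Set.Iio i) (Set.Iic i)) ∧ (List.ofFn f).prod = w

end Coxeter

section Codes

variable {W : Type*} [Group W] {r k : ℕ}

/-- The order on `W` induced by a code `L` from the componentwise order. -/
def LhLE (L : W → Fin k → ℕ) (u v : W) : Prop := L u ≤ L v

/-- `w` is `L`-principal: `[e, w]_Lh = [e, w]` as sets. -/
def IsPrincipal (s : Fin r → W) (L : W → Fin k → ℕ) (w : W) : Prop :=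
  {z | LhLE L 1 z ∧ LhLE L z w} = {z | BruhatLE s 1 z ∧ BruhatLE s z w}

/-- The `L`-orbit of `w`: the codes of `L`-principal elements which are rearrangements
of `L w`. -/
def orbit (s : Fin r → W) (L : W → Fin k → ℕ) (w : W) : Set (Fin k → ℕ) :=
  {x | ∃ u, IsPrincipal s L u ∧ L u = x} ∩ {x | ∃ σ : Equiv.Perm (Fin k), x = L w ∘ σ}

/-- `w` is `L`-unimodal: it is `L`-principal and `L w` is the lexicographic minimum of its
orbit. -/
def IsCodeUnimodal (s : Fin r → W) (L : W → Fin k → ℕ) (w : W) : Prop :=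
  IsPrincipal s L w ∧ IsLeast (toLex '' orbit s L w) (toLex (L w))

/-- Fubini words: `x ∈ {0, …, k - 1}^k` with `{x₁, …, x_k} = {0, …, max x}`. -/
def IsFubiniWord (x : Fin k → ℕ) : Prop :=
  (∀ i, x i < k) ∧ Set.range x = Set.Iic (Finset.univ.sup x)

end Codes

section Symmetric

/-- The simple transpositions of the symmetric group on `m + 1` letters. -/
def simpleTransposition (m : ℕ) (i : Fin m) : Equiv.Perm (Fin (m + 1)) :=
  Equiv.swap i.castSucc i.succ

theorem exists_word {m : ℕ} (w : Equiv.Perm (Fin (m + 1))) :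
    ∃ l, wordProd (simpleTransposition m) l = w := by
  have h : w ∈ Submonoid.closure (Set.range fun i : Fin m => Equiv.swap i.castSucc i.succ) := by
    rw [Equiv.Perm.mclosure_swap_castSucc_succ]; trivial
  induction h using Submonoid.closure_induction with
  | mem x hx =>
    obtain ⟨i, rfl⟩ := hx
    exact ⟨[i], by simp [wordProd, simpleTransposition]⟩
  | one => exact ⟨[], by simp [wordProd]⟩
  | mul x y _ _ hx hy =>
    obtain ⟨a, rfl⟩ := hx
    obtain ⟨b, rfl⟩ := hy
    exact ⟨a ++ b, by simp [wordProd]⟩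

theorem sign_eq_len {m : ℕ} (w : Equiv.Perm (Fin (m + 1))) :
    Equiv.Perm.sign w = (-1) ^ len (simpleTransposition m) w := by
  have key : ∀ l : List (Fin m),
      Equiv.Perm.sign (wordProd (simpleTransposition m) l) = (-1) ^ l.length := by
    intro l
    induction l with
    | nil => simp [wordProd]
    | cons a l ih =>
      simp only [wordProd, List.map_cons, List.prod_cons, map_mul, List.length_cons] at ih ⊢
      rw [ih, simpleTransposition, Equiv.Perm.sign_swap (ne_of_lt (Fin.castSucc_lt_succ (i := a))),
        pow_succ, mul_comm]
  have hne : {k | ∃ l : List (Fin m),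
      wordProd (simpleTransposition m) l = w ∧ l.length = k}.Nonempty := by
    obtain ⟨l, hl⟩ := exists_word w
    exact ⟨l.length, l, hl, rfl⟩
  obtain ⟨l, hl, hk⟩ := Nat.sInf_mem hne
  rw [len, ← hk, ← key, hl]

theorem len_mul_ne {m : ℕ} (i : Fin m) (w : Equiv.Perm (Fin (m + 1))) :
    len (simpleTransposition m) (simpleTransposition m i * w) ≠
      len (simpleTransposition m) w := by
  intro h
  have h1 := sign_eq_len (simpleTransposition m i * w)
  rw [h, ← sign_eq_len, map_mul, simpleTransposition,
    Equiv.Perm.sign_swap (ne_of_lt (Fin.castSucc_lt_succ (i := i)))] at h1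
  rcases Int.units_eq_one_or (Equiv.Perm.sign w) with h2 | h2 <;> rw [h2] at h1 <;>
    exact absurd h1 (by decide)

/-- Each element of `W_J` factors through `W_I` and `^I W_J`, for `I ⊆ J`. -/
theorem exists_left_factor {m : ℕ} {I J : Set (Fin m)} (hIJ : I ⊆ J)
    (w : Equiv.Perm (Fin (m + 1))) (hw : w ∈ parabolic (simpleTransposition m) J) :
    ∃ a ∈ parabolic (simpleTransposition m) I,
      ∃ x ∈ leftQuotient (simpleTransposition m) I J, a * x = w := by
  classical
  have hle : parabolic (simpleTransposition m) I ≤ parabolic (simpleTransposition m) J :=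
    Subgroup.closure_mono (Set.image_mono hIJ)
  have hex : ∃ k, ∃ a ∈ parabolic (simpleTransposition m) I,
      len (simpleTransposition m) (a⁻¹ * w) = k := ⟨_, 1, one_mem _, rfl⟩
  obtain ⟨a, ha, hk⟩ := Nat.find_spec hex
  refine ⟨a, ha, a⁻¹ * w, ⟨mul_mem (inv_mem (hle ha)) hw, fun i hi => ?_⟩, by group⟩
  have hs : simpleTransposition m i ∈ parabolic (simpleTransposition m) I :=
    Subgroup.subset_closure ⟨i, hi, rfl⟩
  refine lt_of_le_of_ne ?_ (len_mul_ne i _).symm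
  rw [hk]
  exact Nat.find_min' hex ⟨a * (simpleTransposition m i)⁻¹, mul_mem ha (inv_mem hs), by
    rw [mul_inv_rev, inv_inv, mul_assoc]⟩

theorem exists_parabolicFactorization {m : ℕ} (w : Equiv.Perm (Fin (m + 1))) :
    ∃ f, IsParabolicFactorization (simpleTransposition m) w f := by
  have key : ∀ k ≤ m, ∀ w ∈ parabolic (simpleTransposition m) {j | (j : ℕ) < k},
      ∃ g : ℕ → Equiv.Perm (Fin (m + 1)),
        (∀ i : Fin m, (i : ℕ) < k →
          g i ∈ leftQuotient (simpleTransposition m) (Set.Iio i) (Set.Iic i)) ∧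
        ((List.range k).map g).prod = w := by
    intro k
    induction k with
    | zero =>
      intro _ w hw
      refine ⟨fun _ => 1, by simp, ?_⟩
      simp [parabolic] at hw
      simp [hw]
    | succ k ih =>
      intro hk w hw
      obtain ⟨a, ha, x, hx, rfl⟩ := exists_left_factor
        (I := {j : Fin m | (j : ℕ) < k}) (J := {j : Fin m | (j : ℕ) < k + 1})
        (fun j hj => Nat.lt_succ_of_lt hj) w hw
      obtain ⟨g, hg, hp⟩ := ih (by omega) a ha
      refine ⟨Function.update g k x, fun i hi => ?_, ?_⟩
      · rcases Nat.lt_succ_iff_lt_or_eq.mp hi with h | h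
        · rw [Function.update_of_ne (by omega)]
          exact hg i h
        · rw [h, Function.update_self]
          have h1 : {j : Fin m | (j : ℕ) < k} = Set.Iio i := by
            ext j; simp [Fin.lt_def, h]
          have h2 : {j : Fin m | (j : ℕ) < k + 1} = Set.Iic i := by
            ext j; simp [Fin.le_def, h]
          rwa [h1, h2] at hx
      · rw [List.range_succ, List.map_append, List.prod_append, ← hp]
        congr 1
        · congr 1
          apply List.map_congr_left
          intro j hj
          rw [Function.update_of_ne (by have := List.mem_range.mp hj; omega)]
        · simp
  have htop : w ∈ parabolic (simpleTransposition m) {j | (j : ℕ) < m} := by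
    obtain ⟨l, rfl⟩ := exists_word w
    refine Subgroup.list_prod_mem _ fun x hx => ?_
    obtain ⟨i, _, rfl⟩ := List.mem_map.mp hx
    exact Subgroup.subset_closure ⟨i, i.2, rfl⟩
  obtain ⟨g, hg, hp⟩ := key m le_rfl w htop
  refine ⟨fun i => g i, fun i => hg i i.2, ?_⟩
  rw [← hp, List.ofFn_eq_map, ← List.map_coe_finRange_eq_range, List.map_map]
  rfl

/-- The factor `w⁽ⁱ⁾` of a permutation. -/
noncomputable def parabolicFactor {m : ℕ} (w : Equiv.Perm (Fin (m + 1))) :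
    Fin m → Equiv.Perm (Fin (m + 1)) :=
  (exists_parabolicFactorization w).choose

/-- The Lehmer code of type `A_m`: `w ↦ (ℓ(w⁽¹⁾), …, ℓ(w⁽ᵐ⁾))`. -/
noncomputable def codeA {m : ℕ} (w : Equiv.Perm (Fin (m + 1))) : Fin m → ℕ :=
  fun i => len (simpleTransposition m) (parabolicFactor w i)

/-- The code `L_n` on `S_n` for `n = m + 1`: the code of type `A_m` with a `0` in front. -/
noncomputable def code (m : ℕ) (w : Equiv.Perm (Fin (m + 1))) : Fin (m + 1) → ℕ :=
  Fin.cons 0 (codeA w)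

/-- Unimodal permutations of `{1, …, m + 1}`: for some `i ∈ {0, …, m + 1}`,
`w(j) < w(j + 1)` for `j < i` and `w(j) > w(j + 1)` for `i < j < m + 1`.
The element `j : Fin m` stands for the position `j + 1`. -/
def IsUnimodalPerm {m : ℕ} (w : Equiv.Perm (Fin (m + 1))) : Prop :=
  ∃ i : ℕ, i ≤ m + 1 ∧
    (∀ j : Fin m, (j : ℕ) + 1 < i → w j.castSucc < w j.succ) ∧
    (∀ j : Fin m, i < (j : ℕ) + 1 → w j.succ < w j.castSucc)

end Symmetric

end Lehmer

/-! The code is an inversion table: its entry at `v` counts the smaller values to the right of `v`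
in one-line notation (`code_eq_invCode`). Every word bounded by `c v ≤ v` is the table of exactly
one permutation, with an explicit reduced word made of descending blocks. Shrinking the table
shortens the blocks, so componentwise order implies Bruhat order, and principality only asks for the
converse below `w` (`isPrincipal_iff`).

Unimodality of `w` means that no value lies between two larger ones. This amounts to the table
having all steps 0 or 1, which for a table is the same as being a weakly increasing Fubini word.

Such a `w` is principal: the values below `v` to the left of `v` precede every value `≥ v`, and a
condition that the first `p` positions carry values below `v` passes to subwords (`lt_of_sublist`).
Conversely a principal `w` has a Fubini code (`IsPrincipal.isFubiniWord`): a skipped value would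
force too long a descending run in a truncation of `w`. Hence the sorted code of a principal element
is again the code of a principal element. It belongs to the orbit and is its lexicographic minimum.
-/

namespace Lehmer

/-! ### Coxeter length as the number of inversions. -/

section Inversions

variable {m : ℕ}

/-- The number of values `x < v` appearing to the right of `v` in one-line notation. -/
def invCode (w : Equiv.Perm (Fin (m + 1))) (v : Fin (m + 1)) : ℕ :=
  (Finset.univ.filter fun x => x < v ∧ w⁻¹ v < w⁻¹ x).card

/-- The inversions of `w`, as pairs of values. -/
def invSet (w : Equiv.Perm (Fin (m + 1))) : Finset (Fin (m + 1) × Fin (m + 1)) :=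
  Finset.univ.filter fun p => p.1 < p.2 ∧ w⁻¹ p.2 < w⁻¹ p.1

theorem card_invSet (w : Equiv.Perm (Fin (m + 1))) :
    (invSet w).card = ∑ v, invCode w v := by
  rw [Finset.card_eq_sum_card_fiberwise (f := Prod.snd) (t := Finset.univ) (by simp)]
  refine Finset.sum_congr rfl fun v _ => ?_
  refine Finset.card_bij (fun p _ => p.1) ?_ ?_ ?_
  · rintro ⟨a, b⟩ h
    simp only [invSet, Finset.mem_filter, Finset.mem_univ, true_and] at h ⊢
    obtain ⟨h, rfl⟩ := h
    exact h
  · rintro ⟨a, b⟩ h ⟨c, d⟩ h' e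
    simp only [invSet, Finset.mem_filter, Finset.mem_univ, true_and] at h h' e
    exact Prod.ext e (h.2.trans h'.2.symm)
  · intro x hx
    exact ⟨(x, v), by simpa [invSet] using hx, rfl⟩

theorem simpleTransposition_mul_self (i : Fin m) :
    simpleTransposition m i * simpleTransposition m i = 1 := by
  simp [simpleTransposition]

theorem simpleTransposition_inv (i : Fin m) :
    (simpleTransposition m i)⁻¹ = simpleTransposition m i := by
  simp [simpleTransposition]

theorem simpleTransposition_mul_cancel (i : Fin m) (w : Equiv.Perm (Fin (m + 1))) :
    simpleTransposition m i * (simpleTransposition m i * w) = w := by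
  rw [← mul_assoc, simpleTransposition_mul_self, one_mul]

theorem inv_simpleTransposition_mul_apply (i : Fin m) (w : Equiv.Perm (Fin (m + 1)))
    (x : Fin (m + 1)) :
    (simpleTransposition m i * w)⁻¹ x = w⁻¹ (simpleTransposition m i x) := by
  simp [mul_inv_rev, simpleTransposition_inv]

theorem simpleTransposition_lt {i : Fin m} {a b : Fin (m + 1)} (hab : a < b)
    (h : ¬(a = i.castSucc ∧ b = i.succ)) :
    simpleTransposition m i a < simpleTransposition m i b := by
  simp only [simpleTransposition, Equiv.swap_apply_def]
  simp only [Fin.ext_iff, Fin.lt_def, Fin.val_castSucc, Fin.val_succ] at *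
  split_ifs <;> (try simp only [Fin.val_castSucc, Fin.val_succ]) <;> omega

/-- A simple transposition of values preserves the order of every pair except its own, so the
inversions are transported by it and only the pair it swaps is new. -/
theorem card_invSet_mul {i : Fin m} {w : Equiv.Perm (Fin (m + 1))}
    (h : w⁻¹ i.castSucc < w⁻¹ i.succ) :
    (invSet (simpleTransposition m i * w)).card = (invSet w).card + 1 := by
  have hs : ∀ x, simpleTransposition m i (simpleTransposition m i x) = x := by
    intro x; simp [simpleTransposition]
  have hc : simpleTransposition m i i.castSucc = i.succ := by simp [simpleTransposition]
  have hd : simpleTransposition m i i.succ = i.castSucc := by simp [simpleTransposition]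
  have hlt : i.castSucc < i.succ := Fin.castSucc_lt_succ
  have e : invSet (simpleTransposition m i * w) =
      insert (i.castSucc, i.succ)
        ((invSet w).image fun p => (simpleTransposition m i p.1, simpleTransposition m i p.2)) := by
    ext ⟨a, b⟩
    simp only [invSet, Finset.mem_insert, Finset.mem_image, Finset.mem_filter, Finset.mem_univ,
      true_and, Prod.mk.injEq, Prod.exists, inv_simpleTransposition_mul_apply]
    constructor
    · rintro ⟨hab, hw⟩
      by_cases hq : a = i.castSucc ∧ b = i.succ
      · exact Or.inl hq
      · exact Or.inr ⟨_, _, ⟨simpleTransposition_lt hab hq, hw⟩, hs _, hs _⟩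
    · rintro (⟨rfl, rfl⟩ | ⟨x, y, ⟨hxy, hw⟩, rfl, rfl⟩)
      · rw [hc, hd]; exact ⟨hlt, h⟩
      · refine ⟨simpleTransposition_lt hxy ?_, by rwa [hs, hs]⟩
        rintro ⟨rfl, rfl⟩
        exact lt_asymm h hw
  rw [e, Finset.card_insert_of_notMem, Finset.card_image_of_injective]
  · rintro ⟨a, b⟩ ⟨c, d⟩ h
    simpa using h
  · simp only [invSet, Finset.mem_image, Finset.mem_filter, Finset.mem_univ,
      true_and, Prod.mk.injEq, Prod.exists, not_exists, not_and]
    rintro x y ⟨hxy, -⟩ h1 h2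
    have h1' := congrArg (simpleTransposition m i) h1
    have h2' := congrArg (simpleTransposition m i) h2
    rw [hs, hc] at h1'
    rw [hs, hd] at h2'
    subst h1' h2'
    exact lt_asymm hlt hxy

theorem inv_castSucc_ne_inv_succ (i : Fin m) (w : Equiv.Perm (Fin (m + 1))) :
    w⁻¹ i.castSucc ≠ w⁻¹ i.succ := fun h =>
  (ne_of_lt (Fin.castSucc_lt_succ (i := i))) (w⁻¹.injective h)

theorem card_invSet_mul_of_gt {i : Fin m} {w : Equiv.Perm (Fin (m + 1))}
    (h : w⁻¹ i.succ < w⁻¹ i.castSucc) :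
    (invSet (simpleTransposition m i * w)).card + 1 = (invSet w).card := by
  have := card_invSet_mul (i := i) (w := simpleTransposition m i * w)
    (by simpa [inv_simpleTransposition_mul_apply, simpleTransposition] using h)
  rw [simpleTransposition_mul_cancel] at this
  exact this.symm

theorem wordProd_nil : wordProd (simpleTransposition m) [] = 1 := rfl

theorem wordProd_cons (i : Fin m) (l : List (Fin m)) :
    wordProd (simpleTransposition m) (i :: l) =
      simpleTransposition m i * wordProd (simpleTransposition m) l := by
  simp [wordProd]

theorem wordProd_append (l l' : List (Fin m)) :
    wordProd (simpleTransposition m) (l ++ l') =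
      wordProd (simpleTransposition m) l * wordProd (simpleTransposition m) l' := by
  simp [wordProd]

theorem card_invSet_wordProd_le (l : List (Fin m)) :
    (invSet (wordProd (simpleTransposition m) l)).card ≤ l.length := by
  induction l with
  | nil =>
    rw [wordProd_nil, List.length_nil, Nat.le_zero, Finset.card_eq_zero]
    ext ⟨a, b⟩
    simp only [invSet, Finset.mem_filter, Finset.mem_univ, true_and, inv_one,
      Equiv.Perm.coe_one, id_eq, Finset.notMem_empty, iff_false, not_and]
    exact fun h => lt_asymm h
  | cons i l ih =>
    rw [wordProd_cons, List.length_cons]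
    rcases lt_or_gt_of_ne (inv_castSucc_ne_inv_succ i (wordProd (simpleTransposition m) l))
      with h | h
    · rw [card_invSet_mul h]; omega
    · have := card_invSet_mul_of_gt h; omega

theorem eq_one_of_ascents {w : Equiv.Perm (Fin (m + 1))}
    (h : ∀ i : Fin m, w⁻¹ i.castSucc < w⁻¹ i.succ) : w = 1 := by
  have hm : StrictMono (w⁻¹ : Equiv.Perm (Fin (m + 1))) := Fin.strictMono_iff_lt_succ.2 h
  exact inv_eq_one.1 (Equiv.ext fun x => congrFun hm.eq_id x)

theorem exists_word_length_eq (w : Equiv.Perm (Fin (m + 1))) :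
    ∃ l, wordProd (simpleTransposition m) l = w ∧ l.length = (invSet w).card := by
  generalize hk : (invSet w).card = k
  induction k generalizing w with
  | zero =>
    refine ⟨[], ?_, rfl⟩
    rw [wordProd_nil]
    refine (eq_one_of_ascents fun i => ?_).symm
    refine lt_of_le_of_ne (not_lt.1 fun h => ?_) (inv_castSucc_ne_inv_succ i w)
    have := card_invSet_mul_of_gt h
    omega
  | succ k ih =>
    by_cases hw : ∀ i : Fin m, w⁻¹ i.castSucc < w⁻¹ i.succ
    -- Without descents `w` is the identity, the product of the empty word, which cannot have `k +
    -- 1` inversions.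
    · have := card_invSet_wordProd_le ([] : List (Fin m))
      rw [wordProd_nil, ← eq_one_of_ascents hw, hk] at this
      simp at this
    · push Not at hw
      obtain ⟨i, hi⟩ := hw
      have h := card_invSet_mul_of_gt (lt_of_le_of_ne hi (inv_castSucc_ne_inv_succ i w).symm)
      obtain ⟨l, hl, hlen⟩ := ih (simpleTransposition m i * w) (by omega)
      exact ⟨i :: l, by rw [wordProd_cons, hl, simpleTransposition_mul_cancel], by simp [hlen]⟩

theorem len_eq_card_invSet (w : Equiv.Perm (Fin (m + 1))) :
    len (simpleTransposition m) w = (invSet w).card := by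
  refine le_antisymm (Nat.sInf_le (exists_word_length_eq w)) ?_
  refine le_csInf ⟨_, exists_word_length_eq w⟩ ?_
  rintro k ⟨l, rfl, rfl⟩
  exact card_invSet_wordProd_le l

theorem len_le_length (l : List (Fin m)) :
    len (simpleTransposition m) (wordProd (simpleTransposition m) l) ≤ l.length := by
  rw [len_eq_card_invSet]; exact card_invSet_wordProd_le l

theorem len_lt_len_mul_iff {i : Fin m} {w : Equiv.Perm (Fin (m + 1))} :
    len (simpleTransposition m) w < len (simpleTransposition m) (simpleTransposition m i * w) ↔
      w⁻¹ i.castSucc < w⁻¹ i.succ := by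
  rw [len_eq_card_invSet, len_eq_card_invSet]
  rcases lt_or_gt_of_ne (inv_castSucc_ne_inv_succ i w) with h | h
  · rw [card_invSet_mul h]; exact iff_of_true (Nat.lt_succ_self _) h
  · have := card_invSet_mul_of_gt h
    constructor
    · intro; omega
    · intro h'; exact absurd h' (lt_asymm h)

theorem isReduced_cons_iff {i : Fin m} {l : List (Fin m)} :
    IsReduced (simpleTransposition m) (i :: l) ↔
      IsReduced (simpleTransposition m) l ∧
        (wordProd (simpleTransposition m) l)⁻¹ i.castSucc <
          (wordProd (simpleTransposition m) l)⁻¹ i.succ := by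
  have h0 := len_le_length l
  simp only [IsReduced, wordProd_cons, List.length_cons]
  rw [len_eq_card_invSet] at *
  rcases lt_or_gt_of_ne (inv_castSucc_ne_inv_succ i (wordProd (simpleTransposition m) l))
    with h | h
  · rw [len_eq_card_invSet, card_invSet_mul h, Nat.add_right_cancel_iff]
    exact (and_iff_left h).symm
  · have := card_invSet_mul_of_gt h
    rw [len_eq_card_invSet]
    constructor
    · intro; omega
    · intro h'; exact absurd h'.2 (lt_asymm h)

/-! ### Exchange, deletion and subwords. -/

/-- The strong exchange property. -/
theorem exists_sublist_swap_mul (l : List (Fin m)) (a b : Fin (m + 1)) (hab : a < b)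
    (h : (wordProd (simpleTransposition m) l)⁻¹ b < (wordProd (simpleTransposition m) l)⁻¹ a) :
    ∃ l' : List (Fin m), l'.Sublist l ∧ wordProd (simpleTransposition m) l' =
      Equiv.swap a b * wordProd (simpleTransposition m) l := by
  induction l generalizing a b with
  | nil => simp [wordProd_nil] at h; exact absurd hab (lt_asymm h)
  | cons j l ih =>
    rw [wordProd_cons, inv_simpleTransposition_mul_apply, inv_simpleTransposition_mul_apply] at h
    by_cases hq : a = j.castSucc ∧ b = j.succ
    · obtain ⟨rfl, rfl⟩ := hq
      refine ⟨l, List.sublist_cons_self _ _, ?_⟩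
      rw [wordProd_cons]
      exact (simpleTransposition_mul_cancel j _).symm
    -- Moving the transposition past the first letter conjugates it; the conjugated pair is still
    -- increasing.
    · obtain ⟨l', hl', e⟩ := ih _ _ (simpleTransposition_lt hab hq) h
      refine ⟨j :: l', hl'.cons_cons j, ?_⟩
      rw [wordProd_cons, e, wordProd_cons, Equiv.swap_apply_apply, simpleTransposition_inv]
      simp only [mul_assoc]
      rw [simpleTransposition_mul_cancel]

/-- The deletion property. -/
theorem exists_isReduced_sublist (l : List (Fin m)) :
    ∃ l' : List (Fin m), l'.Sublist l ∧ IsReduced (simpleTransposition m) l' ∧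
      wordProd (simpleTransposition m) l' = wordProd (simpleTransposition m) l := by
  induction hn : l.length using Nat.strong_induction_on generalizing l with
  | _ n ih =>
    subst hn
    cases l with
    | nil => exact ⟨[], List.Sublist.refl _, (Nat.le_zero.1 (len_le_length [])).symm, rfl⟩
    | cons i l =>
      obtain ⟨l1, h1, h2, h3⟩ := ih l.length (by simp) l rfl
      rcases lt_or_gt_of_ne (inv_castSucc_ne_inv_succ i (wordProd (simpleTransposition m) l1))
        with h | h
      · exact ⟨i :: l1, h1.cons_cons i, isReduced_cons_iff.2 ⟨h2, h⟩, by
          rw [wordProd_cons, wordProd_cons, h3]⟩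
      -- Here the new letter lowers the length: exchange absorbs it by shortening `l1`, and the
      -- induction applies to the result.
      · obtain ⟨l2, h4, h5⟩ := exists_sublist_swap_mul l1 _ _ Fin.castSucc_lt_succ h
        have := h4.length_le
        have := h1.length_le
        obtain ⟨l3, h6, h7, h8⟩ := ih l2.length (by simp only [List.length_cons]; omega) l2 rfl
        refine ⟨l3, ((h6.trans h4).trans h1).cons i, h7, ?_⟩
        rw [h8, h5, h3, wordProd_cons]
        rfl

theorem bruhatLE_of_sublist {l l' : List (Fin m)} (hl : IsReduced (simpleTransposition m) l)
    (h : l'.Sublist l) :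
    BruhatLE (simpleTransposition m) (wordProd (simpleTransposition m) l')
      (wordProd (simpleTransposition m) l) := by
  obtain ⟨l2, h1, h2, h3⟩ := exists_isReduced_sublist l'
  exact ⟨l, hl, rfl, l2, h1.trans h, h2, h3⟩

/-- If the first `p` letters of the product of a reduced word are smaller than `v`, so are those
of the product of any sublist. -/
theorem lt_of_sublist {l l' : List (Fin m)} (hl : IsReduced (simpleTransposition m) l)
    (h : l'.Sublist l) (p v : ℕ)
    (hu : ∀ x : Fin (m + 1), v ≤ (x : ℕ) → p ≤ ((wordProd (simpleTransposition m) l)⁻¹ x : ℕ)) :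
    ∀ x : Fin (m + 1), v ≤ (x : ℕ) → p ≤ ((wordProd (simpleTransposition m) l')⁻¹ x : ℕ) := by
  induction l generalizing l' v with
  | nil => rw [List.sublist_nil.1 h]; exact hu
  | cons i l ih =>
    rw [isReduced_cons_iff] at hl
    simp only [wordProd_cons, inv_simpleTransposition_mul_apply] at hu
    have hc : simpleTransposition m i i.castSucc = i.succ := by simp [simpleTransposition]
    have hd : simpleTransposition m i i.succ = i.castSucc := by simp [simpleTransposition]
    have hs : ∀ x, simpleTransposition m i (simpleTransposition m i x) = x := by
      intro x; simp [simpleTransposition]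
    have hne : ∀ x, x ≠ i.castSucc → x ≠ i.succ → simpleTransposition m i x = x := fun x h1 h2 =>
      Equiv.swap_apply_of_ne_of_ne h1 h2
    by_cases hv : v = i + 1
    · subst hv
      -- This is the only threshold that the letter `i` disturbs. Reducedness puts `i` to the left
      -- of `i + 1` in the tail, so the bound for `i` also covers `i + 1` and the threshold drops to
      -- `i`. This leaves enough room whether the letter is kept or deleted.
      have key : ∀ x : Fin (m + 1), (i : ℕ) ≤ (x : ℕ) → p ≤ ((wordProd (simpleTransposition m) l)⁻¹ x : ℕ) := by
        have h1 := hu i.succ (by simp)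
        rw [hd] at h1
        intro x hx
        by_cases hx1 : x = i.castSucc
        · rw [hx1]; exact h1
        · by_cases hx2 : x = i.succ
          · rw [hx2]; exact h1.trans (Fin.lt_def.1 hl.2).le
          · have := hu x (by
              have : (x : ℕ) ≠ i := fun h => hx1 (Fin.ext h)
              omega)
            rwa [hne x hx1 hx2] at this
      cases h with
      | cons _ h =>
        intro x hx
        exact ih hl.1 h _ key x (by omega)
      | cons_cons _ h =>
        intro x hx
        rw [wordProd_cons, inv_simpleTransposition_mul_apply]
        refine ih hl.1 h _ key _ ?_
        by_cases hx1 : x = i.castSucc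
        · rw [hx1, hc]; simp
        · by_cases hx2 : x = i.succ
          · rw [hx2, hd]; simp
          · rw [hne x hx1 hx2]; omega
    · have inv : ∀ x : Fin (m + 1), v ≤ (x : ℕ) → v ≤ (simpleTransposition m i x : ℕ) := by
        intro x hx
        by_cases hx1 : x = i.castSucc
        · rw [hx1, hc]; rw [hx1] at hx; simp at hx ⊢; omega
        · by_cases hx2 : x = i.succ
          · rw [hx2, hd]; rw [hx2] at hx; simp at hx ⊢; omega
          · rwa [hne x hx1 hx2]
      have key : ∀ x : Fin (m + 1), v ≤ (x : ℕ) → p ≤ ((wordProd (simpleTransposition m) l)⁻¹ x : ℕ) := by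
        intro x hx
        have := hu _ (inv x hx)
        rwa [hs] at this
      cases h with
      | cons _ h => exact ih hl.1 h _ key
      | cons_cons _ h =>
        intro x hx
        rw [wordProd_cons, inv_simpleTransposition_mul_apply]
        exact ih hl.1 h _ key _ (inv x hx)

end Inversions

end Lehmer

namespace Lehmer

/-! ### The code as an inversion table. -/

section Factorization

variable {m : ℕ}

theorem invCode_le (w : Equiv.Perm (Fin (m + 1))) (v : Fin (m + 1)) : invCode w v ≤ v := by
  calc invCode w v ≤ (Finset.Iio v).card :=
        Finset.card_le_card fun x hx => by
          simp only [Finset.mem_filter] at hx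
          exact Finset.mem_Iio.2 hx.2.1
    _ = v := by simp

theorem invCode_zero (w : Equiv.Perm (Fin (m + 1))) : invCode w 0 = 0 :=
  Nat.le_zero.1 (invCode_le w 0)

theorem invCode_eq_zero {w : Equiv.Perm (Fin (m + 1))} {v : Fin (m + 1)}
    (h : ∀ x < v, w⁻¹ x < w⁻¹ v) : invCode w v = 0 := by
  rw [invCode, Finset.card_eq_zero, Finset.filter_eq_empty_iff]
  exact fun x _ hx => lt_asymm (h x hx.1) hx.2

/-- `w` fixes all values from `k` on. -/
def FixesFrom (k : ℕ) (w : Equiv.Perm (Fin (m + 1))) : Prop :=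
  ∀ x : Fin (m + 1), k ≤ (x : ℕ) → w⁻¹ x = x

theorem FixesFrom.lt {k : ℕ} {w : Equiv.Perm (Fin (m + 1))} (h : FixesFrom k w)
    {x : Fin (m + 1)} (hx : (x : ℕ) < k) : ((w⁻¹ x : Fin (m + 1)) : ℕ) < k := by
  by_contra hc
  rw [not_lt] at hc
  have := w⁻¹.injective (h _ hc)
  omega

theorem FixesFrom.mul {k : ℕ} {w w' : Equiv.Perm (Fin (m + 1))} (h : FixesFrom k w)
    (h' : FixesFrom k w') : FixesFrom k (w * w') := fun x hx => by
  rw [mul_inv_rev, Equiv.Perm.mul_apply, h x hx, h' x hx]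

theorem FixesFrom.mono {k l : ℕ} (hkl : k ≤ l) {w : Equiv.Perm (Fin (m + 1))}
    (h : FixesFrom k w) : FixesFrom l w := fun x hx => h x (hkl.trans hx)

theorem FixesFrom.invCode_eq_zero {k : ℕ} {w : Equiv.Perm (Fin (m + 1))} (h : FixesFrom k w)
    {v : Fin (m + 1)} (hv : k ≤ (v : ℕ)) : invCode w v = 0 := by
  refine Lehmer.invCode_eq_zero fun x hx => ?_
  rw [h v hv]
  rcases lt_or_ge (x : ℕ) k with h1 | h1
  · exact Fin.lt_def.2 ((h.lt h1).trans_le hv)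
  · rwa [h x h1]

/-- The generators of index at most `i` move only the values `0, …, i + 1`, whence the bound `i +
2`. -/
theorem fixesFrom_of_mem_parabolic {i : Fin m} {w : Equiv.Perm (Fin (m + 1))}
    (hw : w ∈ parabolic (simpleTransposition m) (Set.Iic i)) : FixesFrom (i + 2) w := by
  induction hw using Subgroup.closure_induction with
  | mem w hw =>
    obtain ⟨j, hj, rfl⟩ := hw
    intro x hx
    rw [simpleTransposition_inv]
    have hj' : (j : ℕ) ≤ i := hj
    refine Equiv.swap_apply_of_ne_of_ne ?_ ?_ <;>
    · rintro rfl
      simp at hx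
      omega
  | one => exact fun x _ => by rw [inv_one]; rfl
  | mul x y _ _ hx hy => exact hx.mul hy
  | inv x _ hx =>
    intro y hy
    rw [inv_inv]
    conv_lhs => rw [← hx y hy]
    exact x.apply_symm_apply y

/-- In an element of the quotient, the values `0, …, i` appear from left to right. -/
theorem lt_of_mem_leftQuotient {i : Fin m} {w : Equiv.Perm (Fin (m + 1))}
    (hw : w ∈ leftQuotient (simpleTransposition m) (Set.Iio i) (Set.Iic i))
    {x y : Fin (m + 1)} (hxy : x < y) (hy : (y : ℕ) ≤ i) : w⁻¹ x < w⁻¹ y := by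
  obtain ⟨x, hx⟩ := x
  obtain ⟨y, hy'⟩ := y
  simp only [Fin.mk_lt_mk] at hxy
  simp only at hy
  induction y with
  | zero => omega
  | succ y ih =>
    have h1 := len_lt_len_mul_iff.1 (hw.2 ⟨y, by omega⟩ (Fin.lt_def.2 (by simp only; omega)))
    rcases Nat.lt_succ_iff_lt_or_eq.1 hxy with h | rfl
    · exact (ih (by omega) (by omega) h).trans h1
    · exact h1

theorem invCode_eq_zero_of_mem_leftQuotient {i : Fin m} {w : Equiv.Perm (Fin (m + 1))}
    (hw : w ∈ leftQuotient (simpleTransposition m) (Set.Iio i) (Set.Iic i))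
    {v : Fin (m + 1)} (hv : v ≠ i.succ) : invCode w v = 0 := by
  rcases le_or_gt (v : ℕ) i with h | h
  · exact invCode_eq_zero fun x hx => lt_of_mem_leftQuotient hw hx h
  · refine (fixesFrom_of_mem_parabolic hw.1).invCode_eq_zero ?_
    have : (v : ℕ) ≠ i + 1 := fun h => hv (Fin.ext (by simpa using h))
    omega

/-- The values up to `i` stay in order and those from `i + 2` on are fixed, so all inversions have
`i + 1` as their larger value. -/
theorem len_of_mem_leftQuotient {i : Fin m} {w : Equiv.Perm (Fin (m + 1))}
    (hw : w ∈ leftQuotient (simpleTransposition m) (Set.Iio i) (Set.Iic i)) :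
    len (simpleTransposition m) w = invCode w i.succ := by
  rw [len_eq_card_invSet, card_invSet]
  exact Fintype.sum_eq_single _ fun v hv => invCode_eq_zero_of_mem_leftQuotient hw hv

/-- The positions under `a` of values up to `i` are again at most `i`, and `w⁻¹` is increasing
there. -/
theorem invCode_mul_of_le {i : Fin m} {a w : Equiv.Perm (Fin (m + 1))}
    (ha : FixesFrom (i + 1) a)
    (hw : w ∈ leftQuotient (simpleTransposition m) (Set.Iio i) (Set.Iic i))
    {v : Fin (m + 1)} (hv : (v : ℕ) ≤ i) : invCode (a * w) v = invCode a v := by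
  rw [invCode, invCode]
  congr 1
  ext x
  simp only [Finset.mem_filter, Finset.mem_univ, true_and, mul_inv_rev, Equiv.Perm.mul_apply]
  refine and_congr_right fun hx => ?_
  have h1 : ((a⁻¹ x : Fin (m + 1)) : ℕ) < i + 1 := ha.lt (by rw [Fin.lt_def] at hx; omega)
  have h2 : ((a⁻¹ v : Fin (m + 1)) : ℕ) < i + 1 := ha.lt (by omega)
  constructor
  · intro h
    by_contra hc
    rcases lt_or_eq_of_le (not_lt.1 hc) with h' | h'
    · exact lt_asymm h (lt_of_mem_leftQuotient hw h' (by omega))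
    · rw [h'] at h; exact lt_irrefl _ h
  · exact fun h => lt_of_mem_leftQuotient hw h (by omega)

/-- `a` only permutes the values below `i + 1` among themselves, which does not change a count over
all of them. -/
theorem invCode_mul_succ {i : Fin m} {a w : Equiv.Perm (Fin (m + 1))}
    (ha : FixesFrom (i + 1) a) : invCode (a * w) i.succ = invCode w i.succ := by
  have hs : a⁻¹ i.succ = i.succ := ha _ (by simp)
  refine Finset.card_bij (fun x _ => a⁻¹ x) ?_ (fun _ _ _ _ h => a⁻¹.injective h) ?_
  · intro x hx
    simp only [Finset.mem_filter, Finset.mem_univ, true_and, mul_inv_rev,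
      Equiv.Perm.mul_apply, hs] at hx ⊢
    refine ⟨Fin.lt_def.2 (ha.lt ?_), hx.2⟩
    exact hx.1
  · intro x hx
    simp only [Finset.mem_filter, Finset.mem_univ, true_and, mul_inv_rev,
      Equiv.Perm.mul_apply, hs] at hx ⊢
    have hax : a⁻¹ (a x) = x := a.symm_apply_apply x
    refine ⟨a x, ⟨?_, by rw [hax]; exact hx.2⟩, hax⟩
    by_contra hc
    have h1 : (i : ℕ) + 1 ≤ (a x : ℕ) := by simpa using Fin.le_def.1 (not_lt.1 hc)
    have h2 := ha _ h1
    rw [hax] at h2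
    rw [← h2] at hc
    exact hc hx.1

theorem invCode_of_isParabolicFactorization {w : Equiv.Perm (Fin (m + 1))}
    {f : Fin m → Equiv.Perm (Fin (m + 1))}
    (hf : IsParabolicFactorization (simpleTransposition m) w f) (i : Fin m) :
    invCode w i.succ = len (simpleTransposition m) (f i) := by
  -- The product of the first `k` factors already has the final entries at the values `1, …, k`; the
  -- next factor sets the entry at `k + 1` and leaves these alone.
  have key : ∀ k : Fin (m + 1), FixesFrom (k + 1) (Fin.partialProd f k) ∧
      ∀ i : Fin m, (i : ℕ) < k →
        invCode (Fin.partialProd f k) i.succ = len (simpleTransposition m) (f i) := by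
    intro k
    induction k using Fin.induction with
    | zero => exact ⟨fun x _ => by simp, by simp⟩
    | succ k ih =>
      rw [Fin.partialProd_succ]
      have ih1 : FixesFrom (k + 1) (Fin.partialProd f k.castSucc) := ih.1
      refine ⟨(ih1.mono (by simp)).mul (fixesFrom_of_mem_parabolic (hf.1 k).1), fun i hi => ?_⟩
      rcases Nat.lt_succ_iff_lt_or_eq.1 hi with h | h
      · rw [invCode_mul_of_le ih1 (hf.1 k) (by simpa using h), ih.2 i h]
      · obtain rfl : i = k := Fin.ext h
        rw [invCode_mul_succ ih1, len_of_mem_leftQuotient (hf.1 i)]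
  have h := (key (Fin.last m)).2 i i.2
  rwa [show Fin.partialProd f (Fin.last m) = w by
    rw [Fin.partialProd, ← hf.2, Fin.val_last, List.take_of_length_le (by simp)]] at h

theorem code_eq_invCode (w : Equiv.Perm (Fin (m + 1))) : code m w = invCode w := by
  funext v
  refine Fin.cases ?_ (fun i => ?_) v
  · rw [invCode_zero]; rfl
  · exact (invCode_of_isParabolicFactorization (exists_parabolicFactorization w).choose_spec i).symm

/-! ### Canonical reduced words and principality. -/

/-- The descending word `s_i s_{i-1} ⋯` with `c` letters. -/
def block (i : Fin m) (c : ℕ) : List (Fin m) :=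
  -- The subtraction truncates at 0, so the word is really descending only for `c ≤ i + 1`.
  (List.range c).map fun t => ⟨i - t, by omega⟩

theorem block_succ (i : Fin m) (c : ℕ) :
    block i (c + 1) = block i c ++ [⟨i - c, by omega⟩] := by
  simp [block, List.range_succ]

theorem block_zero (i : Fin m) : block i 0 = [] := rfl

theorem block_sublist {i : Fin m} {c d : ℕ} (h : c ≤ d) : (block i c).Sublist (block i d) :=
  (List.range_sublist.2 h).map _

/-- The block moves the value `i + 1` to the left by `c` places, and each of the `c` values it
passes moves right by one. -/
theorem wordProd_block_inv_apply (i : Fin m) (c : ℕ) (hc : c ≤ i + 1) (x : Fin (m + 1)) :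
    (((wordProd (simpleTransposition m) (block i c))⁻¹ x : Fin (m + 1)) : ℕ) =
      if (x : ℕ) = i + 1 then i + 1 - c
      else if (x : ℕ) ≤ i ∧ i + 1 ≤ (x : ℕ) + c then x + 1 else x := by
  induction c with
  | zero =>
    rw [block_zero, wordProd_nil, inv_one]
    simp only [Equiv.Perm.coe_one, id_eq]
    split_ifs <;> omega
  | succ c ih =>
    have ih := ih (by omega)
    rw [block_succ, wordProd_append, mul_inv_rev, Equiv.Perm.mul_apply]
    have hw : wordProd (simpleTransposition m) [⟨i - c, by omega⟩] =
        simpleTransposition m ⟨i - c, by omega⟩ := by simp [wordProd]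
    rw [hw, simpleTransposition_inv]
    generalize (wordProd (simpleTransposition m) (block i c))⁻¹ x = y at ih ⊢
    simp only [simpleTransposition, Equiv.swap_apply_def, Fin.ext_iff, Fin.val_castSucc,
      Fin.val_succ]
    split_ifs at ih ⊢ <;> (try simp only [Fin.val_castSucc, Fin.val_succ]) <;> omega

theorem mem_block {i j : Fin m} {c : ℕ} : j ∈ block i c ↔ ∃ t < c, (i : ℕ) - t = j := by
  simp [block, Fin.ext_iff]

theorem wordProd_block_mem (i : Fin m) (c : ℕ) (hc : c ≤ i + 1) :
    wordProd (simpleTransposition m) (block i c) ∈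
      leftQuotient (simpleTransposition m) (Set.Iio i) (Set.Iic i) := by
  constructor
  · refine Subgroup.list_prod_mem _ fun x hx => ?_
    obtain ⟨j, hj, rfl⟩ := List.mem_map.1 hx
    obtain ⟨t, -, ht⟩ := mem_block.1 hj
    exact Subgroup.subset_closure ⟨j, Fin.le_def.2 (by omega), rfl⟩
  · intro j hj
    have hj' : (j : ℕ) < i := hj
    rw [len_lt_len_mul_iff, Fin.lt_def, wordProd_block_inv_apply i c hc,
      wordProd_block_inv_apply i c hc]
    simp only [Fin.val_castSucc, Fin.val_succ]
    split_ifs <;> omega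

theorem len_wordProd_block (i : Fin m) (c : ℕ) (hc : c ≤ i + 1) :
    len (simpleTransposition m) (wordProd (simpleTransposition m) (block i c)) = c := by
  refine le_antisymm ((len_le_length _).trans (by simp [block])) ?_
  rw [len_of_mem_leftQuotient (wordProd_block_mem i c hc), invCode]
  have hi : (i : ℕ) + 1 < m + 1 := by omega
  calc c = (Finset.Ico (⟨i + 1 - c, by omega⟩ : Fin (m + 1)) i.succ).card := by simp; omega
    _ ≤ _ := Finset.card_le_card fun x hx => by
      obtain ⟨h1, h2⟩ := Finset.mem_Ico.1 hx
      simp only [Fin.le_def, Fin.lt_def, Fin.val_succ] at h1 h2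
      simp only [Finset.mem_filter, Finset.mem_univ, true_and, Fin.lt_def,
        wordProd_block_inv_apply i c hc, Fin.val_succ]
      refine ⟨h2, ?_⟩
      split_ifs <;> omega

/-- The concatenation of the descending words with lengths prescribed by `c`. -/
def canonicalWord (c : Fin (m + 1) → ℕ) : List (Fin m) :=
  (List.finRange m).flatMap fun i => block i (c i.succ)

theorem wordProd_flatMap (l : List (Fin m)) (g : Fin m → List (Fin m)) :
    wordProd (simpleTransposition m) (l.flatMap g) =
      (l.map fun i => wordProd (simpleTransposition m) (g i)).prod := by
  induction l with
  | nil => rfl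
  | cons a l ih => rw [List.flatMap_cons, wordProd_append, ih, List.map_cons, List.prod_cons]

theorem invCode_canonicalWord (c : Fin (m + 1) → ℕ) (hc : ∀ v, c v ≤ v) :
    invCode (wordProd (simpleTransposition m) (canonicalWord c)) = c := by
  have hf : IsParabolicFactorization (simpleTransposition m)
      (wordProd (simpleTransposition m) (canonicalWord c))
      fun i => wordProd (simpleTransposition m) (block i (c i.succ)) := by
    refine ⟨fun i => wordProd_block_mem i _ (hc i.succ), ?_⟩
    rw [canonicalWord, wordProd_flatMap, List.ofFn_eq_map]
  funext v
  refine Fin.cases ?_ (fun i => ?_) v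
  · rw [invCode_zero]; exact (Nat.le_zero.1 (hc 0)).symm
  · rw [invCode_of_isParabolicFactorization hf, len_wordProd_block _ _ (hc i.succ)]

/-- Canonical words realise every bounded table, and there are `(m + 1)!` of these, as many as
permutations; so surjectivity gives injectivity. -/
theorem invCode_injective :
    Function.Injective (invCode : Equiv.Perm (Fin (m + 1)) → Fin (m + 1) → ℕ) := by
  let F : Equiv.Perm (Fin (m + 1)) → ((v : Fin (m + 1)) → Fin (v + 1)) := fun w v =>
    ⟨invCode w v, Nat.lt_succ_of_le (invCode_le w v)⟩
  have hsurj : Function.Surjective F := fun c => ⟨wordProd (simpleTransposition m)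
    (canonicalWord fun v => c v), by
      funext v
      exact Fin.ext (congrFun (invCode_canonicalWord (fun v => c v)
        fun v => Nat.le_of_lt_succ (c v).2) v)⟩
  have hcard : Fintype.card (Equiv.Perm (Fin (m + 1))) =
      Fintype.card ((v : Fin (m + 1)) → Fin (v + 1)) := by
    rw [Fintype.card_perm, Fintype.card_pi, Fintype.card_fin, ← Finset.prod_range_add_one_eq_factorial,
      Finset.prod_range]
    simp
  have hinj := ((Fintype.bijective_iff_surjective_and_card F).2 ⟨hsurj, hcard⟩).1
  intro w w' h
  exact hinj (funext fun v => Fin.ext (congrFun h v))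

theorem wordProd_canonicalWord_invCode (w : Equiv.Perm (Fin (m + 1))) :
    wordProd (simpleTransposition m) (canonicalWord (invCode w)) = w :=
  invCode_injective (invCode_canonicalWord _ (invCode_le w))

theorem isReduced_canonicalWord (c : Fin (m + 1) → ℕ) (hc : ∀ v, c v ≤ v) :
    IsReduced (simpleTransposition m) (canonicalWord c) := by
  rw [IsReduced, len_eq_card_invSet, card_invSet, invCode_canonicalWord c hc, Fin.sum_univ_succ,
    Nat.le_zero.1 (hc 0), zero_add, canonicalWord, List.length_flatMap]
  simp only [block, List.length_map, List.length_range]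
  rw [← List.ofFn_eq_map, List.sum_ofFn]

theorem flatMap_sublist_flatMap (l : List (Fin m)) {g h : Fin m → List (Fin m)}
    (hgh : ∀ i, (g i).Sublist (h i)) : (l.flatMap g).Sublist (l.flatMap h) := by
  induction l with
  | nil => exact List.Sublist.refl _
  | cons a l ih => simpa only [List.flatMap_cons] using (hgh a).append ih

theorem bruhatLE_of_invCode_le {z w : Equiv.Perm (Fin (m + 1))} (h : invCode z ≤ invCode w) :
    BruhatLE (simpleTransposition m) z w := by
  rw [← wordProd_canonicalWord_invCode z, ← wordProd_canonicalWord_invCode w]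
  exact bruhatLE_of_sublist (isReduced_canonicalWord _ (invCode_le w))
    (flatMap_sublist_flatMap _ fun i => block_sublist (h i.succ))

theorem isPrincipal_iff {w : Equiv.Perm (Fin (m + 1))} :
    IsPrincipal (simpleTransposition m) (code m) w ↔
      ∀ z, BruhatLE (simpleTransposition m) z w → invCode z ≤ invCode w := by
  have h1 : ∀ z : Equiv.Perm (Fin (m + 1)), invCode (1 : Equiv.Perm (Fin (m + 1))) ≤ invCode z := by
    intro z v
    rw [invCode_eq_zero (w := 1) fun x hx => by simpa using hx]
    exact Nat.zero_le _
  simp only [IsPrincipal, LhLE, code_eq_invCode, Set.ext_iff, Set.mem_ofPred_eq, h1, true_and,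
    fun z => bruhatLE_of_invCode_le (h1 z)]
  exact ⟨fun h z => (h z).2, fun h z => ⟨bruhatLE_of_invCode_le, h z⟩⟩

/-- The canonical word truncated before a position, followed by a letter of the next block, is a
sublist of the canonical word. -/
theorem canonicalWord_truncate_sublist (c : Fin (m + 1) → ℕ) (i p : Fin m)
    (hp : p ∈ block i (c i.succ)) :
    (canonicalWord (fun v => if v < i.succ then c v else 0) ++ [p]).Sublist (canonicalWord c) := by
  obtain ⟨l1, l2, hl⟩ := List.append_of_mem (List.mem_finRange i)
  have hs : (l1 ++ i :: l2).Pairwise (· < ·) := hl ▸ List.pairwise_lt_finRange m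
  rw [List.pairwise_append, List.pairwise_cons] at hs
  obtain ⟨-, ⟨h2, -⟩, h3⟩ := hs
  simp only [canonicalWord, hl, List.flatMap_append, List.flatMap_cons]
  have e1 : (l1.flatMap fun j => block j (if j.succ < i.succ then c j.succ else 0)) =
      l1.flatMap fun j => block j (c j.succ) := by
    refine List.flatMap_congr fun j hj => ?_
    rw [if_pos (Fin.succ_lt_succ_iff.2 (h3 j hj i List.mem_cons_self))]
  have e2 : (l2.flatMap fun j => block j (if j.succ < i.succ then c j.succ else 0)) = [] := by
    rw [List.flatMap_eq_nil_iff]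
    intro j hj
    rw [if_neg (fun h => lt_asymm (h2 j hj) (Fin.succ_lt_succ_iff.1 h)), block_zero]
  rw [e1, e2, if_neg (lt_irrefl _), block_zero, List.append_nil, List.append_nil]
  exact (List.Sublist.refl _).append
    ((List.singleton_sublist.2 hp).trans (List.sublist_append_left _ _))

end Factorization

end Lehmer

namespace Lehmer

/-! ### Unimodal permutations and unit steps. -/

section Unimodal

variable {m : ℕ}

/-- No value separates two larger values in one-line notation. -/
def NonSeparating (w : Equiv.Perm (Fin (m + 1))) : Prop :=
  ∀ y v v' : Fin (m + 1), y < v → y < v' → w⁻¹ y < w⁻¹ v → w⁻¹ y < w⁻¹ v'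

theorem IsUnimodalPerm.nonSeparating {w : Equiv.Perm (Fin (m + 1))} (h : IsUnimodalPerm w) :
    NonSeparating w := by
  obtain ⟨i, -, h1, h2⟩ := h
  have inc : ∀ b : ℕ, ∀ (hb : b < m + 1) (a : Fin (m + 1)), (a : ℕ) < b → b < i →
      w a < w ⟨b, hb⟩ := by
    intro b
    induction b with
    | zero => intro _ a ha; omega
    | succ b ih =>
      intro hb a ha hi
      have h3 := h1 ⟨b, by omega⟩ hi
      rcases Nat.lt_succ_iff_lt_or_eq.1 ha with h | h
      · exact (ih (by omega) a h (by omega)).trans h3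
      · rw [show a = ⟨b, by omega⟩ from Fin.ext h]
        exact h3
  have dec : ∀ b : ℕ, ∀ (hb : b < m + 1) (a : Fin (m + 1)), (a : ℕ) < b → i ≤ a →
      w ⟨b, hb⟩ < w a := by
    intro b
    induction b with
    | zero => intro _ a ha; omega
    | succ b ih =>
      intro hb a ha hi
      have h3 := h2 ⟨b, by omega⟩ (by simp only; omega)
      rcases Nat.lt_succ_iff_lt_or_eq.1 ha with h | h
      · exact h3.trans (ih (by omega) a h hi)
      · rw [show a = ⟨b, by omega⟩ from Fin.ext h]
        exact h3
  intro y v v' hv hv' hp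
  have hw : ∀ x, w (w⁻¹ x) = x := fun x => w.apply_symm_apply x
  by_contra hc
  have hc : w⁻¹ v' < w⁻¹ y :=
    lt_of_le_of_ne (not_lt.1 hc) fun h => hv'.ne' (w⁻¹.injective h)
  rcases lt_or_ge ((w⁻¹ y : Fin (m + 1)) : ℕ) i with h | h
  · have := inc _ (w⁻¹ y).2 _ hc h
    rw [Fin.eta, hw, hw] at this
    exact lt_asymm this hv'
  · have := dec _ (w⁻¹ v).2 _ hp h
    rw [Fin.eta, hw, hw] at this
    exact lt_asymm this hv

theorem NonSeparating.isUnimodalPerm {w : Equiv.Perm (Fin (m + 1))} (h : NonSeparating w) :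
    IsUnimodalPerm w := by
  have hw : ∀ x, w⁻¹ (w x) = x := fun x => w.symm_apply_apply x
  have hcs : ∀ j : Fin m, w j.castSucc ≠ w j.succ := fun j e =>
    (Fin.castSucc_lt_succ (i := j)).ne (w.injective e)
  -- The peak is the position of the largest value, shifted by one because the definition counts
  -- positions from 1. A descent before it, or an ascent after it, would make the smaller neighbour
  -- separate the larger one from the maximum.
  refine ⟨(w⁻¹ (Fin.last m) : Fin (m + 1)) + 1, by omega, fun j hj => ?_, fun j hj => ?_⟩
  · refine lt_of_le_of_ne (not_lt.1 fun hc => ?_) (hcs j)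
    have hl : w j.succ < Fin.last m := hc.trans_le (Fin.le_last _)
    have hne : w⁻¹ (Fin.last m) ≠ j.succ := fun e => by
      have := hw j.succ
      rw [← e] at this
      exact hl.ne (w⁻¹.injective (by rw [hw, e]))
    have h1 := h _ _ _ hl hc (by
      rw [hw]
      refine lt_of_le_of_ne ?_ hne.symm
      rw [Fin.le_def, Fin.val_succ]; omega)
    rw [hw, hw] at h1
    exact lt_asymm h1 Fin.castSucc_lt_succ
  · refine lt_of_le_of_ne (not_lt.1 fun hc => ?_) (hcs j).symm
    have h1 := h _ _ _ hc (hc.trans_le (Fin.le_last _)) (by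
      rw [hw, hw]; exact Fin.castSucc_lt_succ)
    rw [hw, Fin.lt_def, Fin.val_castSucc] at h1
    omega

/-- A word all of whose steps are `0` or `1`. -/
def UnitSteps (c : Fin (m + 1) → ℕ) : Prop :=
  ∀ i : Fin m, c i.succ = c i.castSucc ∨ c i.succ = c i.castSucc + 1

theorem UnitSteps.monotone {c : Fin (m + 1) → ℕ} (h : UnitSteps c) : Monotone c :=
  Fin.monotone_iff_le_succ.2 fun i => by rcases h i with h | h <;> omega

theorem unitSteps_iff {c : Fin (m + 1) → ℕ} (hc : ∀ v, c v ≤ v) :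
    IsFubiniWord c ∧ Monotone c ↔ UnitSteps c := by
  constructor
  · rintro ⟨⟨-, hr⟩, hm⟩ i
    have h1 : c i.castSucc ≤ c i.succ := hm Fin.castSucc_lt_succ.le
    by_contra hcon
    -- A jump of at least 2 skips this value, and monotonicity prevents it from being taken
    -- elsewhere.
    have h2 : c i.castSucc + 1 ∈ Set.range c := by
      rw [hr, Set.mem_Iic]
      exact le_trans (by omega) (Finset.le_sup (f := c) (Finset.mem_univ i.succ))
    obtain ⟨x, hx⟩ := h2
    rcases lt_or_ge x i.succ with h | h
    · have := hm (Fin.le_castSucc_iff.2 h)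
      omega
    · have := hm h
      omega
  · intro h
    refine ⟨⟨fun v => (hc v).trans_lt v.2, ?_⟩, h.monotone⟩
    have key : ∀ v : Fin (m + 1), ∀ k ≤ c v, k ∈ Set.range c := by
      intro v
      induction v using Fin.induction with
      | zero => exact fun k hk => ⟨0, le_antisymm ((hc 0).trans (Nat.zero_le _)) hk⟩
      | succ v ih =>
        intro k hk
        rcases Nat.le_or_eq_of_le_succ (show k ≤ c v.castSucc + 1 by rcases h v with h | h <;> omega)
          with h1 | h1
        · exact ih k h1
        · rcases h v with h2 | h2
          · exact ih k (by omega)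
          · exact ⟨v.succ, h2.trans h1.symm⟩
    ext k
    constructor
    · rintro ⟨v, rfl⟩
      exact Finset.le_sup (f := c) (Finset.mem_univ v)
    · intro hk
      obtain ⟨v, -, hv⟩ := Finset.exists_mem_eq_sup Finset.univ Finset.univ_nonempty c
      exact key v k (hv ▸ hk)

theorem invCode_succ (w : Equiv.Perm (Fin (m + 1))) (i : Fin m) :
    invCode w i.succ =
      (Finset.univ.filter fun x => x < i.castSucc ∧ w⁻¹ i.succ < w⁻¹ x).card +
        if w⁻¹ i.succ < w⁻¹ i.castSucc then 1 else 0 := by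
  have hlt : ∀ x : Fin (m + 1), x < i.succ ↔ x = i.castSucc ∨ x < i.castSucc := fun x => by
    rw [← Fin.le_castSucc_iff, le_iff_eq_or_lt]
  split_ifs with h
  · rw [invCode, ← Finset.card_insert_of_notMem (a := i.castSucc) (by simp)]
    congr 1
    ext x
    simp only [Finset.mem_filter, Finset.mem_insert, Finset.mem_univ, true_and, hlt]
    constructor
    · rintro ⟨h1 | h1, h2⟩
      · exact Or.inl h1
      · exact Or.inr ⟨h1, h2⟩
    · rintro (rfl | ⟨h1, h2⟩)
      · exact ⟨Or.inl rfl, h⟩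
      · exact ⟨Or.inr h1, h2⟩
  · rw [invCode, add_zero]
    congr 1
    ext x
    simp only [Finset.mem_filter, Finset.mem_univ, true_and, hlt]
    constructor
    · rintro ⟨rfl | h1, h2⟩
      · exact absurd h2 h
      · exact ⟨h1, h2⟩
    · exact fun ⟨h1, h2⟩ => ⟨Or.inr h1, h2⟩

/-- A value below both `i` and `i + 1` lies on the same side of each, so their entries differ only
by whether `i + 1` precedes `i`. -/
theorem NonSeparating.unitSteps {w : Equiv.Perm (Fin (m + 1))} (h : NonSeparating w) :
    UnitSteps (invCode w) := by
  intro i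
  have e : (Finset.univ.filter fun x => x < i.castSucc ∧ w⁻¹ i.succ < w⁻¹ x).card =
      invCode w i.castSucc := by
    rw [invCode]
    congr 1
    ext x
    simp only [Finset.mem_filter, Finset.mem_univ, true_and]
    refine and_congr_right fun hx => ?_
    have hx' : x < i.succ := hx.trans Fin.castSucc_lt_succ
    have h1 := h _ _ _ hx hx'
    have h2 := h _ _ _ hx' hx
    have h3 : w⁻¹ x ≠ w⁻¹ i.castSucc := fun e => hx.ne (w⁻¹.injective e)
    have h4 : w⁻¹ x ≠ w⁻¹ i.succ := fun e => hx'.ne (w⁻¹.injective e)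
    constructor
    · exact fun h5 => lt_of_le_of_ne (not_lt.1 fun h6 => lt_asymm h5 (h1 h6)) h3.symm
    · exact fun h5 => lt_of_le_of_ne (not_lt.1 fun h6 => lt_asymm h5 (h2 h6)) h4.symm
  rw [invCode_succ, e]
  split_ifs
  · exact Or.inr rfl
  · exact Or.inl rfl

theorem nonSeparating_of_unitSteps {w : Equiv.Perm (Fin (m + 1))} (h : UnitSteps (invCode w)) :
    NonSeparating w := by
  have key : ∀ (i : Fin m) (y : Fin (m + 1)), y < i.castSucc →
      (w⁻¹ i.castSucc < w⁻¹ y ↔ w⁻¹ i.succ < w⁻¹ y) := by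
    intro i
    have hs := h i
    rw [invCode_succ] at hs
    -- One of the two sets contains the other, according to the relative position of `i` and `i +
    -- 1`; the unit step forces equal cardinalities.
    have e : (Finset.univ.filter fun x => x < i.castSucc ∧ w⁻¹ i.castSucc < w⁻¹ x) =
        Finset.univ.filter fun x => x < i.castSucc ∧ w⁻¹ i.succ < w⁻¹ x := by
      rcases lt_or_gt_of_ne (inv_castSucc_ne_inv_succ i w) with h1 | h1
      · rw [if_neg (lt_asymm h1)] at hs
        refine (Finset.eq_of_subset_of_card_le (fun x hx => ?_) ?_).symm
        · simp only [Finset.mem_filter, Finset.mem_univ, true_and] at hx ⊢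
          exact ⟨hx.1, h1.trans hx.2⟩
        · rw [invCode] at hs; omega
      · rw [if_pos h1] at hs
        refine Finset.eq_of_subset_of_card_le (fun x hx => ?_) ?_
        · simp only [Finset.mem_filter, Finset.mem_univ, true_and] at hx ⊢
          exact ⟨hx.1, h1.trans hx.2⟩
        · rw [invCode] at hs; omega
    intro y hy
    have := Finset.ext_iff.1 e y
    simpa only [Finset.mem_filter, Finset.mem_univ, true_and, hy] using this
  have chain : ∀ (y v : Fin (m + 1)), y < v → ∀ (b : ℕ) (hb : b < m + 1), (v : ℕ) ≤ b →
      (w⁻¹ v < w⁻¹ y ↔ w⁻¹ ⟨b, hb⟩ < w⁻¹ y) := by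
    intro y v hy b
    induction b with
    | zero =>
      intro hb hv
      rw [show v = ⟨0, hb⟩ from Fin.ext (Nat.le_zero.1 hv)]
    | succ b ih =>
      intro hb hv
      rcases Nat.le_or_eq_of_le_succ hv with h1 | h1
      · exact (ih (by omega) h1).trans (key ⟨b, by omega⟩ y (Fin.lt_def.2 (by
          have := Fin.lt_def.1 hy
          simp only [Fin.val_castSucc]; omega)))
      · rw [show v = ⟨b + 1, hb⟩ from Fin.ext h1]
  intro y v v' hv hv' hp
  have e : w⁻¹ v < w⁻¹ y ↔ w⁻¹ v' < w⁻¹ y := by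
    rcases le_total v v' with h1 | h1
    · exact chain y v hv v' v'.2 h1
    · exact (chain y v' hv' v v.2 h1).symm
  refine lt_of_le_of_ne (not_lt.1 fun h1 => lt_asymm hp (e.2 h1)) fun h1 => ?_
  exact hv'.ne (w⁻¹.injective h1)

theorem isUnimodalPerm_iff_unitSteps {w : Equiv.Perm (Fin (m + 1))} :
    IsUnimodalPerm w ↔ UnitSteps (invCode w) :=
  ⟨fun h => h.nonSeparating.unitSteps, fun h => (nonSeparating_of_unitSteps h).isUnimodalPerm⟩

/-! ### Principality against the shape of the code. -/

theorem card_add_invCode (w : Equiv.Perm (Fin (m + 1))) (v : Fin (m + 1)) :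
    (Finset.univ.filter fun x => x < v ∧ w⁻¹ x < w⁻¹ v).card + invCode w v = v := by
  rw [invCode, ← Finset.card_union_of_disjoint]
  · rw [← Finset.filter_or, ← Fin.card_Iio]
    congr 1
    ext x
    simp only [Finset.mem_filter, Finset.mem_univ, true_and, Finset.mem_Iio, ← and_or_left,
      and_iff_left_iff_imp]
    exact fun h => lt_or_gt_of_ne fun e => h.ne (w⁻¹.injective e)
  · rw [Finset.disjoint_filter]
    exact fun x _ h h' => lt_asymm h.2 h'.2

theorem card_le_of_inv_lt {w : Equiv.Perm (Fin (m + 1))} {s : Finset (Fin (m + 1))}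
    {b : Fin (m + 1)} (h : ∀ x ∈ s, w⁻¹ x < b) : s.card ≤ b := by
  rw [← Fin.card_Iio]
  exact Finset.card_le_card_of_injOn (fun x => w⁻¹ x) (fun x hx => by simpa using h x hx)
    w⁻¹.injective.injOn

theorem NonSeparating.isPrincipal {u : Equiv.Perm (Fin (m + 1))} (h : NonSeparating u) :
    IsPrincipal (simpleTransposition m) (code m) u := by
  rw [isPrincipal_iff]
  rintro z ⟨l, hl, rfl, l', hs, -, rfl⟩ v
  set u := wordProd (simpleTransposition m) l
  set z := wordProd (simpleTransposition m) l'
  set p := (Finset.univ.filter fun x => x < v ∧ u⁻¹ x < u⁻¹ v).card with hp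
  -- The `p` smaller values to the left of `v` are also to the left of every `x ≥ v`, since none of
  -- them separates `v` from `x`.
  have hu : ∀ x : Fin (m + 1), (v : ℕ) ≤ x → p ≤ ((u⁻¹ x : Fin (m + 1)) : ℕ) := by
    intro x hx
    refine card_le_of_inv_lt (w := u) fun y hy => ?_
    simp only [Finset.mem_filter, Finset.mem_univ, true_and] at hy
    exact h _ _ _ hy.1 (hy.1.trans_le hx) hy.2
  have hz := lt_of_sublist hl hs p v hu
  have hpv := hz v le_rfl
  have hzz : ∀ x, z⁻¹ (z x) = x := fun x => z.symm_apply_apply x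
  -- The first `p` positions of `z` carry values below `v`, all to the left of `v`.
  have hle : p ≤ (Finset.univ.filter fun x => x < v ∧ z⁻¹ x < z⁻¹ v).card := by
    calc p = (Finset.Iio (⟨p, hpv.trans_lt (z⁻¹ v).2⟩ : Fin (m + 1))).card := by simp
      _ ≤ _ := Finset.card_le_card_of_injOn (fun a => z a) (fun a ha => ?_) z.injective.injOn
    have ha' : (a : ℕ) < p := by simpa [Fin.lt_def] using ha
    simp only [Finset.coe_filter, Finset.mem_univ, true_and, Set.mem_ofPred_eq, hzz]
    refine ⟨lt_of_not_ge fun hc => ?_, Fin.lt_def.2 (ha'.trans_le hpv)⟩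
    have := hz _ (Fin.le_def.1 hc)
    rw [hzz] at this
    omega
  have h1 := card_add_invCode u v
  have h2 := card_add_invCode z v
  rw [← hp] at h1
  exact Nat.le_of_add_le_add_left (h2.le.trans (h1.ge.trans (Nat.add_le_add_right hle _)))

/-- Exchanging adjacent entries in increasing order moves the larger one left past the smaller,
which adds an inversion. -/
theorem invCode_mul_simpleTransposition {a : Equiv.Perm (Fin (m + 1))} {p : Fin m}
    (h : a p.castSucc < a p.succ) :
    invCode a (a p.succ) < invCode (a * simpleTransposition m p) (a p.succ) := by
  have ha : ∀ x, a⁻¹ (a x) = x := fun x => a.symm_apply_apply x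
  have hc : simpleTransposition m p p.castSucc = p.succ := by simp [simpleTransposition]
  have hd : simpleTransposition m p p.succ = p.castSucc := by simp [simpleTransposition]
  rw [invCode, invCode, ← Nat.succ_le_iff, Nat.succ_eq_add_one,
    ← Finset.card_insert_of_notMem (a := a p.castSucc)]
  · refine Finset.card_le_card fun x hx => ?_
    simp only [Finset.mem_insert, Finset.mem_filter, Finset.mem_univ, true_and, mul_inv_rev,
      Equiv.Perm.mul_apply, simpleTransposition_inv, ha, hd] at hx ⊢
    rcases hx with rfl | ⟨h1, h2⟩
    · rw [ha, hc]; exact ⟨h, Fin.castSucc_lt_succ⟩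
    · have h3 : p.castSucc < a⁻¹ x := Fin.castSucc_lt_succ.trans h2
      refine ⟨h1, ?_⟩
      rw [simpleTransposition, Equiv.swap_apply_of_ne_of_ne h3.ne' h2.ne']
      exact h3
  · simp only [Finset.mem_filter, Finset.mem_univ, true_and, ha, not_and]
    exact fun _ => lt_asymm Fin.castSucc_lt_succ

theorem IsPrincipal.isFubiniWord {w : Equiv.Perm (Fin (m + 1))}
    (h : IsPrincipal (simpleTransposition m) (code m) w) : IsFubiniWord (invCode w) := by
  rw [isPrincipal_iff] at h
  refine ⟨fun v => (invCode_le w v).trans_lt v.2, Set.Subset.antisymm ?_ fun k hk => ?_⟩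
  · rintro _ ⟨v, rfl⟩
    exact Finset.le_sup (f := invCode w) (Finset.mem_univ v)
  by_contra hkr
  have hne : ∀ v, invCode w v ≠ k := fun v hv => hkr ⟨v, hv⟩
  have hk0 : k ≠ 0 := fun e => hne 0 (by rw [invCode_zero, e])
  obtain ⟨v0, -, hv0⟩ :=
    Finset.exists_mem_eq_sup Finset.univ Finset.univ_nonempty (invCode w)
  have hex : ∃ v, k < invCode w v :=
    ⟨v0, lt_of_le_of_ne (hv0 ▸ hk) (hne v0).symm⟩
  -- At the first entry exceeding the skipped value `k`, all earlier entries are below `k`.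
  obtain ⟨v, hv, hmin⟩ :=
    WellFounded.has_min (wellFounded_lt (α := Fin (m + 1))) {v | k < invCode w v} hex
  have hv : k < invCode w v := hv
  have hlow : ∀ x < v, invCode w x < k := fun x hx =>
    lt_of_le_of_ne (not_lt.1 fun hc => hmin x hc hx) (hne x)
  obtain ⟨i, rfl⟩ : ∃ i : Fin m, v = i.succ := by
    refine (Fin.eq_zero_or_eq_succ v).resolve_left ?_
    rintro rfl
    rw [invCode_zero] at hv
    omega
  have hki : k ≤ i := by
    have := invCode_le w i.succ
    rw [Fin.val_succ] at this
    omega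
  set c : Fin (m + 1) → ℕ := fun x => if x < i.succ then invCode w x else 0 with hcdef
  have hc : ∀ x, c x ≤ x := fun x => by
    simp only [hcdef]
    split_ifs
    · exact invCode_le w x
    · exact Nat.zero_le _
  set a := wordProd (simpleTransposition m) (canonicalWord c) with hadef
  have hac : invCode a = c := invCode_canonicalWord c hc
  have hack : ∀ x, invCode a x < k := fun x => by
    rw [hac]
    simp only [hcdef]
    split_ifs with hx
    · exact hlow x hx
    · omega
  have haa : ∀ x, a⁻¹ (a x) = x := fun x => a.symm_apply_apply x
  -- The block at `i` has more than `k` letters, so it contains `p`, and `a * s_p` lies below `w`.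
  -- An ascent of `a` at `p` would make the entry of `a * s_p` at `a p.succ` exceed that of `w`,
  -- against principality.
  have hdesc : ∀ p : Fin m, (i : ℕ) - k ≤ p → p < i → a p.succ < a p.castSucc := by
    intro p hp1 hp2
    refine lt_of_le_of_ne (not_lt.1 fun hlt => ?_) fun e =>
      (Fin.castSucc_lt_succ (i := p)).ne' (a.injective e)
    have hp2' : (p : ℕ) < i := hp2
    have hmem : p ∈ block i (invCode w i.succ) := mem_block.2 ⟨i - p, by omega, by omega⟩
    have hb := bruhatLE_of_sublist (isReduced_canonicalWord _ (invCode_le w))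
      (canonicalWord_truncate_sublist (invCode w) i p hmem)
    rw [wordProd_canonicalWord_invCode, wordProd_append] at hb
    have h1 := h _ hb (a p.succ)
    have h2 := invCode_mul_simpleTransposition hlt
    rw [show wordProd (simpleTransposition m) [p] = simpleTransposition m p by
      simp [wordProd]] at h1
    have h3 := h2.trans_le h1
    rw [hac] at h3
    simp only [hcdef] at h3
    split_ifs at h3 with hx
    · exact lt_irrefl _ h3
    -- A value beyond the truncation has entry 0, so all smaller values precede it; being at least
    -- `i + 1`, it cannot sit at position `p + 1 ≤ i`.
    · have h4 : invCode a (a p.succ) = 0 := by rw [hac]; simp only [hcdef]; rw [if_neg hx]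
      have h5 := card_add_invCode a (a p.succ)
      have h6 := card_le_of_inv_lt (w := a) (b := p.succ)
        (s := Finset.univ.filter fun x => x < a p.succ ∧ a⁻¹ x < a⁻¹ (a p.succ)) (by
          intro x hx
          simp only [Finset.mem_filter, haa] at hx
          exact hx.2.2)
      rw [h4, add_zero] at h5
      rw [h5, Fin.val_succ] at h6
      have h7 := Fin.le_def.1 (not_lt.1 hx)
      rw [Fin.val_succ] at h7
      omega
  have hdec : ∀ b : ℕ, ∀ (hb : b < m + 1), i - k < b → b ≤ i →
      a ⟨b, hb⟩ < a ⟨i - k, by omega⟩ := by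
    intro b
    induction b with
    | zero => intro _ hb; omega
    | succ b ih =>
      intro hb h1 h2
      have h3 := hdesc ⟨b, by omega⟩ (by simp only; omega) (Fin.lt_def.2 (by simp only; omega))
      rcases Nat.lt_succ_iff_lt_or_eq.1 h1 with h4 | h4
      · exact h3.trans (ih (by omega) h4 (by omega))
      · simp only [h4]
        exact h3
  refine (hack (a ⟨i - k, by omega⟩)).not_ge ?_
  -- The `k` descents put `k` smaller values to the right of the value at position `i - k`, whose
  -- entry should be below `k`.
  calc k = (Finset.Ioc (⟨i - k, by omega⟩ : Fin (m + 1)) i.castSucc).card := by simp; omega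
    _ ≤ _ := Finset.card_le_card_of_injOn (fun x => a x) (fun x hx => ?_) a.injective.injOn
  have hx := Finset.mem_Ioc.1 (Finset.mem_coe.1 hx)
  simp only [Finset.coe_filter, Finset.mem_univ, true_and, Set.mem_ofPred_eq, haa]
  exact ⟨hdec x x.2 hx.1 hx.2, hx.1⟩

/-! ### Rearrangements and lexicographic minimality. -/

theorem toLex_le_comp_perm {n : ℕ} {f : Fin n → ℕ} (hf : Monotone f)
    (σ : Equiv.Perm (Fin n)) : toLex f ≤ toLex (f ∘ σ) := by
  refine not_lt.1 fun hlt => ?_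
  obtain ⟨i, h1, h2⟩ := hlt
  have h1 : ∀ j < i, f (σ j) = f j := h1
  have h2 : f (σ i) < f i := h2
  -- Entries of `f` below `f i` occur before `i`, where both words agree; the rearrangement has a
  -- further one at `i`. But rearranging cannot change the count.
  have hss : (Finset.univ.filter fun j => f j < f i) ⊂
      Finset.univ.filter fun j => f (σ j) < f i := by
    rw [Finset.ssubset_iff_of_subset]
    · exact ⟨i, by simpa using h2, by simp⟩
    · intro j hj
      simp only [Finset.mem_filter, Finset.mem_univ, true_and] at hj ⊢
      rwa [h1 j (lt_of_not_ge fun hc => (hf hc).not_gt hj)]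
  refine (Finset.card_lt_card hss).ne' (Finset.card_bij (fun j _ => σ j) ?_ ?_ ?_)
  · intro j hj; simpa using hj
  · exact fun _ _ _ _ e => σ.injective e
  · exact fun j hj => ⟨σ.symm j, by simpa using hj, σ.apply_symm_apply j⟩

theorem IsFubiniWord.comp_perm {n : ℕ} {f : Fin n → ℕ} (hf : IsFubiniWord f)
    (σ : Equiv.Perm (Fin n)) : IsFubiniWord (f ∘ σ) := by
  refine ⟨fun i => hf.1 _, ?_⟩
  rw [σ.surjective.range_comp, hf.2]
  congr 1
  refine le_antisymm (Finset.sup_le fun i _ => ?_) (Finset.sup_le fun i _ => ?_)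
  · have := Finset.le_sup (f := f ∘ σ) (Finset.mem_univ (σ.symm i))
    simpa using this
  · exact Finset.le_sup (f := f) (Finset.mem_univ (σ i))

/-- This makes a sorted Fubini word the inversion table of a permutation. -/
theorem IsFubiniWord.le_of_monotone {c : Fin (m + 1) → ℕ} (hf : IsFubiniWord c)
    (hm : Monotone c) (v : Fin (m + 1)) : c v ≤ v := by
  have h0 : c 0 = 0 := by
    have : 0 ∈ Set.range c := by rw [hf.2]; exact Nat.zero_le _
    obtain ⟨x, hx⟩ := this
    exact Nat.le_zero.1 ((hm (Fin.zero_le x)).trans_eq hx)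
  induction v using Fin.induction with
  | zero => simp [h0]
  | succ i ih =>
    by_contra hcon
    rw [Fin.val_succ] at hcon
    rw [Fin.val_castSucc] at ih
    have h2 : (i : ℕ) + 1 ∈ Set.range c := by
      rw [hf.2, Set.mem_Iic]
      exact le_trans (by omega) (Finset.le_sup (f := c) (Finset.mem_univ i.succ))
    obtain ⟨x, hx⟩ := h2
    rcases lt_or_ge x i.succ with h | h
    · have := hm (Fin.le_castSucc_iff.2 h)
      omega
    · have := hm h
      omega

end Unimodal

end Lehmer

theorem mainTheorem12 (m : ℕ) (u : Equiv.Perm (Fin (m + 1))) :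
    List.TFAE
      [Lehmer.IsCodeUnimodal (Lehmer.simpleTransposition m) (Lehmer.code m) u,
        Lehmer.IsFubiniWord (Lehmer.code m u) ∧ Monotone (Lehmer.code m u),
        Lehmer.IsUnimodalPerm u] := by
  open Lehmer in
  have principal_of_unitSteps : ∀ w : Equiv.Perm (Fin (m + 1)), UnitSteps (invCode w) →
      IsPrincipal (simpleTransposition m) (code m) w := fun w h =>
    (nonSeparating_of_unitSteps h).isPrincipal
  have h23 : (Lehmer.IsFubiniWord (Lehmer.code m u) ∧ Monotone (Lehmer.code m u)) ↔
      Lehmer.IsUnimodalPerm u := by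
    rw [Lehmer.code_eq_invCode, Lehmer.unitSteps_iff (Lehmer.invCode_le u),
      Lehmer.isUnimodalPerm_iff_unitSteps]
  tfae_have 2 ↔ 3 := h23
  tfae_have 3 → 1 := by
    intro h
    have hp := principal_of_unitSteps u (Lehmer.isUnimodalPerm_iff_unitSteps.1 h)
    refine ⟨hp, ⟨_, ⟨⟨u, hp, rfl⟩, 1, rfl⟩, rfl⟩, ?_⟩
    rintro _ ⟨_, ⟨-, σ, rfl⟩, rfl⟩
    exact Lehmer.toLex_le_comp_perm (h23.2 h).2 σ
  tfae_have 1 → 2 := by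
    rintro ⟨hp, hl⟩
    have hF := hp.isFubiniWord
    rw [← Lehmer.code_eq_invCode] at hF
    refine ⟨hF, ?_⟩
    set L := Lehmer.code m u with hL
    set σ := Tuple.sort L
    have hmono : Monotone (L ∘ σ) := Tuple.monotone_sort L
    have hF' := hF.comp_perm σ
    have hle := hF'.le_of_monotone hmono
    have hw := Lehmer.invCode_canonicalWord (L ∘ σ) hle
    have hpw := principal_of_unitSteps _ 
      (by rw [hw]; exact (Lehmer.unitSteps_iff hle).1 ⟨hF', hmono⟩)
    -- The sorted code is the code of a principal element, so it competes in the orbit; as no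
    -- rearrangement is smaller than the sorted one, the two coincide.
    have h1 : toLex L ≤ toLex (L ∘ σ) :=
      hl.2 ⟨_, ⟨⟨_, hpw, (Lehmer.code_eq_invCode _).trans hw⟩, σ, rfl⟩, rfl⟩
    have h2 := Lehmer.toLex_le_comp_perm hmono σ.symm
    have h3 : (L ∘ σ) ∘ σ.symm = L := by
      funext x
      simp
    rw [h3] at h2
    rw [toLex_inj.1 (le_antisymm h1 h2)]
    exact hmono
  tfae_finish
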